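/- Let $n\ge 1$, $m=2n$, and let $A=(a_{jk})$, $B=(b_{jk})$ be complex $m\times m$ matrices ($1\le j\le m$, $0\le k\le m-1$) such that the boundary forms $$U_j(y)=\sum_{k=0}^{m-1}\bigl(a_{jk}\,y^{(k)}(0)+b_{jk}\,y^{(k)}(1)\bigr),\qquad j=1,\dots,m,$$ are linearly independent. Let $L_0y=(-i)^m y^{(m)}$ be the operator in $L^2(0,1)$ with domain $$D(L_0)=\{y\in W_2^m[0,1]:\ U_j(y)=0,\ j=1,\dots,m\},$$ and suppose that $L_0$ is dissipative, that is, $\operatorname{Im}(L_0y,y)\ge 0$ for all $y\in D(L_0)$. Then the boundary conditions $U_j(y)=0$ are Birkhoff-regular, in the following sense. The conditions can be normalized: replacing them by $m$ linearly independent linear combinations of them, one can obtain equivalent conditions of the form $$\alpha_j y^{(k_j)}(0)+\beta_j y^{(k_j)}(1)+\sum_{s<k_j}\bigl(\alpha_{js}y^{(s)}(0)+\beta_{js}y^{(s)}(1)\bigr)=0,\qquad j=1,\dots,m,$$ with $m-1\ge k_1\ge k_2\ge\dots\ge k_m\ge 0$, where for each order $r$ the pairs $(\alpha_j,\beta_j)$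 with $k_j=r$ are linearly independent (so each pair is nonzero and $k_j>k_{j+2}$). Let $\omega_1,\dots,\omega_m$ be the $m$-th roots of $-1$, numbered so that $$\operatorname{Re}\bigl(\omega_1e^{i\pi/(2m)}\bigr)<\dots<\operatorname{Re}\bigl(\omega_me^{i\pi/(2m)}\bigr).$$ For every such normalized system, at least one of the numbers $\theta_{-1},\theta_1$ defined by $$\frac{\theta_{-1}}{s}+\theta_0+\theta_1s=\det\bigl(c_{jl}(s)\,\omega_l^{k_j}\bigr)_{j,l=1}^{m}\qquad(s\ne0)$$ is nonzero, where $c_{jl}(s)=\alpha_j$ for $l<n$, $c_{jn}(s)=\alpha_j+s\beta_j$, $c_{j,n+1}(s)=\alpha_j+\frac1s\beta_j$, and $c_{jl}(s)=\beta_j$ for $l>n+1$. -/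

import Mathlib

open Set MeasureTheory

/-- The space of square integrable functions with `m` derivatives on the unit interval (`m ≥ 1`), each
class being given by its continuous representative: `y` is `m - 1` times continuously
differentiable on `[0,1]`, the derivative of order `m - 1` is absolutely continuous on `[0,1]`,
and the derivative of order `m` (which then exists almost everywhere) is square integrable.
Only the values of `y` on `[0,1]` matter. -/
def MemSobolevTwo (m : ℕ) (y : ℝ → ℂ) : Prop :=
  ContDiffOn ℝ ((m - 1 : ℕ) : WithTop ℕ∞) y (Icc 0 1) ∧
  AbsolutelyContinuousOnInterval (iteratedDerivWithin (m - 1) y (Icc 0 1)) 0 1 ∧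
  MemLp (iteratedDerivWithin m y (Icc 0 1)) 2 (volume.restrict (Icc 0 1))

/-- The vector `(y(x), y'(x), …, y^(m-1)(x))` at a point `x` of `[0,1]`; at the end points the
derivatives are one-sided. -/
noncomputable def jet (m : ℕ) (y : ℝ → ℂ) (x : ℝ) : Fin m → ℂ :=
  fun k => iteratedDerivWithin (k : ℕ) y (Icc 0 1) x

/-- The boundary forms
`U_j(y) = ∑ k, (A j k * y^(k)(0) + B j k * y^(k)(1))`, `j = 1, …, m`. -/
noncomputable def boundaryForm {m : ℕ} (A B : Matrix (Fin m) (Fin m) ℂ) (j : Fin m)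
    (y : ℝ → ℂ) : ℂ :=
  ∑ k : Fin m, (A j k * jet m y 0 k + B j k * jet m y 1 k)

/-- The domain of `L₀`. -/
def operatorDomain {m : ℕ} (A B : Matrix (Fin m) (Fin m) ℂ) : Set (ℝ → ℂ) :=
  {y | MemSobolevTwo m y ∧ ∀ j, boundaryForm A B j y = 0}

/-- The differential expression `l₀(y) = (-i)^m y^(m)` on `[0,1]`. -/
noncomputable def diffExpr (m : ℕ) (y : ℝ → ℂ) (x : ℝ) : ℂ :=
  (-Complex.I) ^ m * iteratedDerivWithin m y (Icc 0 1) x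

/-- The inner product of `L²(0,1)`, linear in the first argument. -/
noncomputable def innerL2 (f g : ℝ → ℂ) : ℂ :=
  ∫ x in (0 : ℝ)..1, f x * (starRingEnd ℂ) (g x)

/-- The boundary conditions `U_j(y) = 0` are dissipative: `Im (L₀ y, y) ≥ 0` on the domain
of `L₀`. -/
def IsDissipativeBC {m : ℕ} (A B : Matrix (Fin m) (Fin m) ℂ) : Prop :=
  ∀ y ∈ operatorDomain A B, 0 ≤ (innerL2 (diffExpr m y) y).im

/-- The boundary forms with coefficients `(A, B)` are linearly independent, that is, the rows of
the `m × 2m` matrix `(A | B)` are. -/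
def IndependentBC {m : ℕ} (A B : Matrix (Fin m) (Fin m) ℂ) : Prop :=
  LinearIndependent ℂ (fun j : Fin m => (Sum.elim (A j) (B j) : Fin m ⊕ Fin m → ℂ))

/-- `(C, D)` arises from `(A, B)` by an invertible passage to linear combinations of the
boundary conditions. -/
def EquivalentBC {m : ℕ} (A B C D : Matrix (Fin m) (Fin m) ℂ) : Prop :=
  ∃ G : Matrix (Fin m) (Fin m) ℂ, IsUnit G ∧ C = G * A ∧ D = G * B

/-- The boundary conditions with coefficients `(C, D)` are normalized, with orders
`k_1 ≥ k_2 ≥ … ≥ k_m`. The `j`-th condition contains no derivative of order above `k_j`,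
and for every `r` the pairs `(α_j, β_j) = (C j r, D j r)` of leading coefficients of the
conditions of order `r` are linearly independent, so that no linear combination of these
conditions has smaller order. In particular each `(α_j, β_j)` is nonzero (hence
`k_j` is the order of the `j`-th condition), there are at most two conditions of each order,
and `k_j > k_{j+2}`. -/
structure IsNormalizedBC {m : ℕ} (C D : Matrix (Fin m) (Fin m) ℂ) (k : Fin m → Fin m) :
    Prop where
  antitone : Antitone k
  order_le : ∀ j s, k j < s → C j s = 0 ∧ D j s = 0
  leading : ∀ r : Fin m,
    LinearIndependent ℂ (fun j : {j : Fin m // k j = r} => ![C j r, D j r])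

/-- `ω_1, …, ω_m` are the `m`-th roots of `-1`, numbered so that
`Re (ω_1 e^{iπ/(2m)}) < … < Re (ω_m e^{iπ/(2m)})`. -/
def IsOrderedRoots (m : ℕ) (ω : Fin m → ℂ) : Prop :=
  (∀ j, ω j ^ m = -1) ∧
  StrictMono (fun j => (ω j * Complex.exp (Complex.I * Real.pi / (2 * m))).re)

/-- The numbering of the roots exists. It is unique: the condition forces the `m` numbers `ω_j` to
be distinct, and it fixes their order. -/
theorem exists_isOrderedRoots (m : ℕ) : ∃ ω : Fin m → ℂ, IsOrderedRoots m ω := by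
  rcases Nat.eq_zero_or_pos m with rfl | hm
  · exact ⟨fun _ => 0, fun j => j.elim0, fun j => j.elim0⟩
  have hm0 : (m : ℝ) ≠ 0 := by positivity
  have hmC : (m : ℂ) ≠ 0 := by exact_mod_cast hm.ne'
  set z : Fin m → ℂ := fun l =>
    Complex.exp (Complex.I * Real.pi * (2 * (l : ℕ) + 1) / m) with hz
  have hpow : ∀ l, z l ^ m = -1 := by
    intro l
    rw [hz]
    simp only
    rw [← Complex.exp_nat_mul]
    have : (m : ℂ) * (Complex.I * Real.pi * (2 * (l : ℕ) + 1) / m)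
        = ((l : ℕ) : ℂ) * (2 * Real.pi * Complex.I) + Real.pi * Complex.I := by
      field_simp
    rw [this, Complex.exp_add, Complex.exp_nat_mul_two_pi_mul_I, Complex.exp_pi_mul_I, one_mul]
  set f : Fin m → ℝ := fun l =>
    (z l * Complex.exp (Complex.I * Real.pi / (2 * m))).re with hf
  have hcos : ∀ l, f l = Real.cos (Real.pi * (4 * (l : ℕ) + 3) / (2 * m)) := by
    intro l
    rw [hf, hz]
    simp only
    rw [← Complex.exp_add]
    have : Complex.I * Real.pi * (2 * (l : ℕ) + 1) / m + Complex.I * Real.pi / (2 * m)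
        = ((Real.pi * (4 * (l : ℕ) + 3) / (2 * m) : ℝ) : ℂ) * Complex.I := by
      push_cast
      field_simp
      ring
    rw [this, Complex.exp_ofReal_mul_I_re]
  have hinj : Function.Injective f := by
    intro a b hab
    rw [hcos, hcos, Real.cos_eq_cos_iff] at hab
    obtain ⟨q, hq | hq⟩ := hab
    · have h1 : ((b : ℕ) : ℝ) = q * m + (a : ℕ) := by
        have hpi := Real.pi_ne_zero
        field_simp at hq
        linarith
      have h2 : ((b : ℕ) : ℤ) = q * m + (a : ℕ) := by exact_mod_cast h1
      have ha := a.2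
      have hb := b.2
      have hq0 : q = 0 := by
        by_contra hne
        rcases lt_or_gt_of_ne hne with h | h
        · nlinarith
        · nlinarith
      subst hq0
      apply Fin.ext
      simp at h2
      exact h2.symm
    · exfalso
      have h1 : (4 * ((b : ℕ) : ℝ) + 3) = 4 * (q * m) - (4 * (a : ℕ) + 3) := by
        have hpi := Real.pi_ne_zero
        field_simp at hq
        linarith
      have h2 : (4 * ((b : ℕ) : ℤ) + 3) = 4 * (q * m) - (4 * (a : ℕ) + 3) := by
        exact_mod_cast h1
      omega
  have hcard : (Finset.univ.image f).card = m := by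
    rw [Finset.card_image_of_injective _ hinj, Finset.card_univ, Fintype.card_fin]
  have hex : ∀ j : Fin m, ∃ l, f l = (Finset.univ.image f).orderEmbOfFin hcard j := by
    intro j
    have := Finset.orderEmbOfFin_mem (Finset.univ.image f) hcard j
    obtain ⟨l, _, h⟩ := Finset.mem_image.1 this
    exact ⟨l, h⟩
  choose σ hσ using hex
  refine ⟨fun j => z (σ j), fun j => hpow _, ?_⟩
  intro i j hij
  have h := ((Finset.univ.image f).orderEmbOfFin hcard).strictMono hij
  rw [← hσ, ← hσ] at h
  exact h

/-- The matrix whose determinant defines regularity in the even case `m = 2 n`. With the columns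
numbered `l = 1, …, 2n`, the entry in row `j` and column `l` is
`c * ω_l ^ k_j`, where `c = α_j` for `l < n`, `c = α_j + s β_j` for `l = n`,
`c = α_j + β_j / s` for `l = n + 1`, and `c = β_j` for `l > n + 1`. In the code the columns are
numbered from `0`. -/
noncomputable def regularityMatrix (n : ℕ) (α β : Fin (2 * n) → ℂ)
    (k : Fin (2 * n) → Fin (2 * n)) (ω : Fin (2 * n) → ℂ) (s : ℂ) :
    Matrix (Fin (2 * n)) (Fin (2 * n)) ℂ :=
  Matrix.of fun j l =>
    (if (l : ℕ) + 1 < n then α j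
     else if (l : ℕ) + 1 = n then α j + s * β j
     else if (l : ℕ) = n then α j + 1 / s * β j
     else β j) * ω l ^ (k j : ℕ)

/-- Regularity of normalized boundary conditions of even order `2 n`: in
`θ₋₁ / s + θ₀ + θ₁ s = det (regularityMatrix …)`, at least one of `θ₋₁`, `θ₁` is not zero. -/
def IsRegularNormalizedBC (n : ℕ) (C D : Matrix (Fin (2 * n)) (Fin (2 * n)) ℂ)
    (k : Fin (2 * n) → Fin (2 * n)) (ω : Fin (2 * n) → ℂ) : Prop :=
  ∃ θneg θzero θpos : ℂ,
    (∀ s : ℂ, s ≠ 0 →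
      θneg / s + θzero + θpos * s =
        (regularityMatrix n (fun j => C j (k j)) (fun j => D j (k j)) k ω s).det) ∧
    (θneg ≠ 0 ∨ θpos ≠ 0)

/-- Birkhoff regularity of boundary conditions of even order `2 n`: they can be normalized, and
however this is done, the normalized conditions are regular. The numbering `ω` of the roots
exists and is unique (`exists_isOrderedRoots` below). -/
def IsBirkhoffRegularBC (n : ℕ) (A B : Matrix (Fin (2 * n)) (Fin (2 * n)) ℂ) : Prop :=
  (∃ C D k, EquivalentBC A B C D ∧ IsNormalizedBC C D k) ∧
  ∀ C D k, EquivalentBC A B C D → IsNormalizedBC C D k →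
    ∀ ω, IsOrderedRoots (2 * n) ω → IsRegularNormalizedBC n C D k ω

/-!
Integration by parts turns the dissipativity of `L₀` into a statement about boundary values: with
`H` the imaginary part of the Lagrange concomitant, `(-1) ^ n * (H w - H u) ≥ 0` whenever `u`, `w`
satisfy the boundary conditions as the vectors of derivatives at `0` and `1`. In normalized
conditions substitute `x ↦ t x` and let `t → 0`: the inequality survives for the principal parts
alone. A principal condition only involves derivatives of one order, so changing the sign of all
derivatives of order at least `n` preserves the principal conditions, while it changes the sign of
`H`. Hence `H u = H w` on their solutions.

The coefficient `θ₋₁` is the determinant of the matrix with columns `α_j ω_l ^ k_j` for `l ≤ n` and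
`β_j ω_l ^ k_j` for `l > n`. A vector in its kernel gives two exponential solutions of
`y^(m) = -iy`, one decaying and one growing, whose derivatives at the origin satisfy the principal
conditions as `u` and `w` respectively. Since `H' = -2 |y|²` along such a solution, `H u > 0` unless
the first vanishes, and `H w < 0` unless the second does. As `H u = H w`, both vanish, and
`θ₋₁ ≠ 0`.
-/

open Filter Matrix
open scoped ComplexConjugate Topology

/-! ### The Lagrange identity -/

/-- The vector `(y(x), y'(x), …, y^(m-1)(x))` of a function on the whole line. Unlike those of
`jet`, its derivatives are two-sided. -/
noncomputable def lineJet (m : ℕ) (y : ℝ → ℂ) (x : ℝ) : Fin m → ℂ :=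
  fun k => iteratedDeriv k y x

/-- The Lagrange concomitant `∑ j, (-1)^j v_(m-1-j) * conj v_j` of the differential expression
`y^(m)`, as a function of the vector `v` of derivatives of `y` at a point. -/
noncomputable def concomitant {m : ℕ} (v : Fin m → ℂ) : ℂ :=
  ∑ j : Fin m, (-1) ^ (j : ℕ) * v j.rev * conj (v j)

theorem continuous_concomitant {m : ℕ} : Continuous (concomitant (m := m)) := by
  unfold concomitant
  fun_prop

theorem concomitant_zero {m : ℕ} : concomitant (0 : Fin m → ℂ) = 0 := by
  simp [concomitant]

theorem concomitant_mul {m : ℕ} {a : Fin m → ℂ} {r : ℂ} (ha : ∀ s, a s.rev * conj (a s) = r)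
    (v : Fin m → ℂ) : concomitant (a * v) = r * concomitant v := by
  simp only [concomitant, Finset.mul_sum, Pi.mul_apply, map_mul]
  refine Finset.sum_congr rfl fun s _ => ?_
  rw [← ha s]
  ring

theorem hasDerivAt_iteratedDeriv {𝕜 F : Type*} [NontriviallyNormedField 𝕜] [NormedAddCommGroup F]
    [NormedSpace 𝕜 F] {y : 𝕜 → F} {n : WithTop ℕ∞} (hy : ContDiff 𝕜 n y) {k : ℕ} (hk : k < n)
    (x : 𝕜) : HasDerivAt (iteratedDeriv k y) (iteratedDeriv (k + 1) y x) x := by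
  rw [iteratedDeriv_succ]
  exact (hy.differentiable_iteratedDeriv k hk x).hasDerivAt

theorem hasDerivAt_concomitant {m : ℕ} {y : ℝ → ℂ} (hy : ContDiff ℝ m y) (x : ℝ) :
    HasDerivAt (fun x => concomitant (lineJet m y x))
      (iteratedDeriv m y x * conj (y x) - (-1) ^ m * (y x * conj (iteratedDeriv m y x))) x := by
  let a : ℕ → ℂ := fun j => (-1) ^ j * iteratedDeriv (m - j) y x * conj (iteratedDeriv j y x)
  have hasDerivAt_summand (j : Fin m) : HasDerivAt
      (fun x => (-1) ^ (j : ℕ) * lineJet m y x j.rev * conj (lineJet m y x j))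
      (a j - a (j + 1)) x := by
    have hderiv (i : Fin m) := hasDerivAt_iteratedDeriv hy (Nat.cast_lt.2 i.2) x
    refine (((hderiv j.rev).const_mul ((-1 : ℂ) ^ (j : ℕ))).mul (hderiv j).star).congr_deriv ?_
    have hrev : (j.rev : ℕ) = m - (j + 1) := Fin.val_rev j
    have hrev_succ : m - (j + 1) + 1 = m - j := by omega
    simp only [a, hrev, hrev_succ, pow_succ, starRingEnd_apply]
    ring
  refine (HasDerivAt.fun_sum fun j _ => hasDerivAt_summand j).congr_deriv ?_
  rw [Fin.sum_univ_eq_sum_range (fun j => a j - a (j + 1)), Finset.sum_range_sub']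
  simp [a, mul_assoc]

theorem hasDerivAt_concomitant_im {m : ℕ} (hm : Even m) {y : ℝ → ℂ} (hy : ContDiff ℝ m y)
    (x : ℝ) :
    HasDerivAt (fun x => (concomitant (lineJet m y x)).im)
      (2 * (iteratedDeriv m y x * conj (y x)).im) x := by
  refine (Complex.imCLM.hasFDerivAt.comp_hasDerivAt x (hasDerivAt_concomitant hy x)).congr_deriv ?_
  simp only [hm.neg_one_pow, Complex.imCLM_apply, Complex.sub_im, Complex.mul_im,
    Complex.conj_re, Complex.conj_im, one_mul]
  ring

theorem concomitant_im_sub_eq_integral {m : ℕ} (hm : Even m) {y : ℝ → ℂ}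
    (hy : ContDiff ℝ m y) (a b : ℝ) :
    (concomitant (lineJet m y b)).im - (concomitant (lineJet m y a)).im =
      2 * (∫ x in a..b, iteratedDeriv m y x * conj (y x)).im := by
  have hcont : Continuous fun x => iteratedDeriv m y x * conj (y x) :=
    (hy.continuous_iteratedDeriv m le_rfl).mul (Complex.continuous_conj.comp hy.continuous)
  have him := Complex.imCLM.intervalIntegral_comp_comm (hcont.intervalIntegrable (μ := volume) a b)
  simp only [Complex.imCLM_apply] at him
  rw [← him, ← intervalIntegral.integral_const_mul]
  refine (intervalIntegral.integral_eq_sub_of_hasDerivAt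
    (fun x _ => hasDerivAt_concomitant_im hm hy x) ?_).symm
  exact ((Complex.continuous_im.comp hcont).const_mul 2).intervalIntegrable a b

/-! ### Dissipativity as a property of the boundary values -/

theorem exists_contDiff_eventuallyEq_nhds {E F : Type*} [NormedAddCommGroup E] [NormedSpace ℝ E]
    [HasContDiffBump E] [NormedAddCommGroup F] [NormedSpace ℝ F] {n : ℕ∞} {a b : E} (hab : a ≠ b)
    {f g : E → F} (hf : ContDiff ℝ n f) (hg : ContDiff ℝ n g) :
    ∃ h : E → F, ContDiff ℝ n h ∧ h =ᶠ[𝓝 a] f ∧ h =ᶠ[𝓝 b] g := by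
  have hdist : 0 < dist a b := dist_pos.2 hab
  let φ : ContDiffBump a := ⟨dist a b / 4, dist a b / 2, by linarith, by linarith⟩
  have hb : b ∉ tsupport φ := by
    rw [φ.tsupport_eq, Metric.mem_closedBall, dist_comm, not_le]
    exact half_lt_self hdist
  refine ⟨fun x => φ x • f x + (1 - φ x) • g x,
    (φ.contDiff.smul hf).add ((contDiff_const.sub φ.contDiff).smul hg), ?_, ?_⟩
  · filter_upwards [φ.eventuallyEq_one] with x hx
    simp [hx]
  · filter_upwards [notMem_tsupport_iff_eventuallyEq.1 hb] with x hx
    simp [hx]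

open scoped ContDiff in
theorem exists_contDiff_iteratedDeriv_eq {F : Type*} [NormedAddCommGroup F] [NormedSpace ℝ F]
    {m : ℕ} (a : ℝ) (u : Fin m → F) :
    ∃ f : ℝ → F, ContDiff ℝ ∞ f ∧ ∀ k : Fin m, iteratedDeriv k f a = u k := by
  let p : ℝ → F := fun x => ∑ j : Fin m, x ^ (j : ℕ) • ((j : ℕ).factorial : ℝ)⁻¹ • u j
  have hp : ContDiff ℝ ∞ p := by fun_prop
  refine ⟨fun x => p (x - a), hp.comp (contDiff_id.sub contDiff_const), fun k => ?_⟩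
  have hsummand (j : Fin m) : iteratedDeriv k
      (fun x : ℝ => x ^ (j : ℕ) • ((j : ℕ).factorial : ℝ)⁻¹ • u j) 0 =
        if k = j then u j else 0 := by
    rw [iteratedDeriv_smul_const (by fun_prop), iteratedDeriv_fun_pow_zero]
    split_ifs with hval hkj hkj
    · rw [smul_smul, mul_inv_cancel₀ (by positivity), one_smul]
    · exact absurd (Fin.ext hval) hkj
    · exact absurd (congrArg Fin.val hkj) hval
    · rw [Nat.cast_zero, zero_smul]
  have hshift : iteratedDeriv k (fun x => p (x - a)) a = iteratedDeriv k p 0 := by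
    simp only [iteratedDeriv_comp_sub_const, sub_self]
  rw [hshift, iteratedDeriv_fun_sum fun j _ => by fun_prop]
  simp only [hsummand, Finset.sum_ite_eq, Finset.mem_univ, if_true]

open scoped ContDiff in
theorem exists_contDiff_lineJet_eq {m : ℕ} {a b : ℝ} (hab : a ≠ b) (u w : Fin m → ℂ) :
    ∃ y : ℝ → ℂ, ContDiff ℝ ∞ y ∧ lineJet m y a = u ∧ lineJet m y b = w := by
  obtain ⟨f, hf, hfu⟩ := exists_contDiff_iteratedDeriv_eq a u
  obtain ⟨g, hg, hgw⟩ := exists_contDiff_iteratedDeriv_eq b w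
  obtain ⟨y, hy, hyf, hyg⟩ := exists_contDiff_eventuallyEq_nhds hab hf hg
  exact ⟨y, hy, funext fun k => (hyf.iteratedDeriv_eq k).trans (hfu k),
    funext fun k => (hyg.iteratedDeriv_eq k).trans (hgw k)⟩

theorem iteratedDerivWithin_Icc_eqOn_iteratedDeriv {F : Type*} [NormedAddCommGroup F]
    [NormedSpace ℝ F] {a b : ℝ} (hab : a < b) {y : ℝ → F} {k : ℕ} (hy : ContDiff ℝ k y) :
    EqOn (iteratedDerivWithin k y (Icc a b)) (iteratedDeriv k y) (Icc a b) :=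
  fun _ hx => iteratedDerivWithin_eq_iteratedDeriv (uniqueDiffOn_Icc hab) hy.contDiffAt hx

theorem jet_eq_lineJet {m : ℕ} {y : ℝ → ℂ} (hy : ContDiff ℝ m y) {x : ℝ} (hx : x ∈ Icc 0 1) :
    jet m y x = lineJet m y x :=
  funext fun k => iteratedDerivWithin_Icc_eqOn_iteratedDeriv zero_lt_one
    (hy.of_le (Nat.cast_le.2 k.2.le)) hx

theorem boundaryForm_eq {m : ℕ} (A B : Matrix (Fin m) (Fin m) ℂ) (j : Fin m) (y : ℝ → ℂ) :
    boundaryForm A B j y = (A *ᵥ jet m y 0 + B *ᵥ jet m y 1) j :=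
  Finset.sum_add_distrib

theorem innerL2_diffExpr {m : ℕ} {y : ℝ → ℂ} (hy : ContDiff ℝ m y) :
    innerL2 (diffExpr m y) y =
      (-Complex.I) ^ m * ∫ x in (0 : ℝ)..1, iteratedDeriv m y x * conj (y x) := by
  rw [innerL2, ← intervalIntegral.integral_const_mul]
  refine intervalIntegral.integral_congr fun x hx => ?_
  rw [uIcc_of_le zero_le_one] at hx
  simp only [diffExpr, iteratedDerivWithin_Icc_eqOn_iteratedDeriv zero_lt_one hy hx, mul_assoc]

theorem memSobolevTwo_of_contDiff {m : ℕ} (hm : 0 < m) {y : ℝ → ℂ} (hy : ContDiff ℝ m y) :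
    MemSobolevTwo m y := by
  obtain ⟨k, rfl⟩ := Nat.exists_eq_add_of_lt hm
  simp only [zero_add] at hy ⊢
  have hyk : ContDiff ℝ k y := hy.of_le (Nat.cast_le.2 k.le_succ)
  refine ⟨hyk.contDiffOn, ContDiffOn.absolutelyContinuousOnInterval ?_, ?_⟩
  · rw [uIcc_of_le zero_le_one]
    refine ContDiffOn.congr (ContDiff.contDiffOn ?_)
      (iteratedDerivWithin_Icc_eqOn_iteratedDeriv zero_lt_one hyk)
    rw [iteratedDeriv_eq_iterate]
    exact ContDiff.iterate_deriv' 1 k (by simpa [add_comm] using hy)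
  · have hcont : Continuous (iteratedDeriv (k + 1) y) := hy.continuous_iteratedDeriv _ le_rfl
    obtain ⟨K, hK⟩ := isCompact_Icc.exists_bound_of_continuousOn
      (hcont.continuousOn (s := Icc (0 : ℝ) 1))
    refine (memLp_congr_ae ?_).1 (MemLp.of_bound hcont.aestronglyMeasurable K
      ((ae_restrict_mem measurableSet_Icc).mono hK))
    exact (ae_restrict_mem measurableSet_Icc).mono fun x hx =>
      (iteratedDerivWithin_Icc_eqOn_iteratedDeriv zero_lt_one hy hx).symm

theorem IsDissipativeBC.concomitant_nonneg {n : ℕ} (hn : 0 < n)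
    {A B : Matrix (Fin (2 * n)) (Fin (2 * n)) ℂ} (h : IsDissipativeBC A B)
    {u w : Fin (2 * n) → ℂ} (huw : A *ᵥ u + B *ᵥ w = 0) :
    0 ≤ (-1) ^ n * ((concomitant w).im - (concomitant u).im) := by
  obtain ⟨y, hy, rfl, rfl⟩ := exists_contDiff_lineJet_eq (zero_ne_one' ℝ) u w
  replace hy : ContDiff ℝ (2 * n : ℕ) y := contDiff_infty.1 hy _
  have hdom : y ∈ operatorDomain A B := by
    refine ⟨memSobolevTwo_of_contDiff (by omega) hy, fun j => ?_⟩
    rw [boundaryForm_eq, jet_eq_lineJet hy (by simp), jet_eq_lineJet hy (by simp), huw]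
    rfl
  have hnonneg := h y hdom
  have hsign : (-Complex.I) ^ (2 * n) = ((-1 : ℝ) ^ n : ℝ) := by
    rw [pow_mul, neg_sq, Complex.I_sq]
    norm_cast
  rw [innerL2_diffExpr hy, hsign, Complex.im_ofReal_mul] at hnonneg
  rw [concomitant_im_sub_eq_integral (even_two_mul n) hy]
  linarith


/-! ### Exponential solutions of `y^(m) = -iy` -/

theorem concomitant_im_pos_of_tendsto_zero {m : ℕ} (hm : Even m) {y : ℝ → ℂ}
    (hy : ContDiff ℝ m y) (hode : ∀ x, iteratedDeriv m y x = -Complex.I * y x)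
    (hlim : Tendsto (lineJet m y) atTop (𝓝 0)) {a b : ℝ} (hab : a < b) (hb : y b ≠ 0) :
    0 < (concomitant (lineJet m y a)).im := by
  let F : ℝ → ℝ := fun x => (concomitant (lineJet m y x)).im
  have hderiv (x : ℝ) : HasDerivAt F (-(2 * Complex.normSq (y x))) x := by
    refine (hasDerivAt_concomitant_im hm hy x).congr_deriv ?_
    rw [hode, mul_assoc, Complex.mul_conj]
    simp
  have hanti : Antitone F := antitone_of_hasDerivAt_nonpos hderiv fun x =>
    neg_nonpos.2 (mul_nonneg zero_le_two (Complex.normSq_nonneg _))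
  have hlimF : Tendsto F atTop (𝓝 0) := by
    have h := (Complex.continuous_im.comp continuous_concomitant).tendsto (0 : Fin m → ℂ)
    rw [Function.comp_apply, concomitant_zero, Complex.zero_im] at h
    exact h.comp hlim
  have hnonneg (x : ℝ) : 0 ≤ F x := hanti.le_of_tendsto hlimF x
  refine (hnonneg a).lt_of_ne fun hFa => hb ?_
  have hzero : F =ᶠ[𝓝 b] fun _ => 0 := by
    filter_upwards [Ioi_mem_nhds hab] with x hx
    exact le_antisymm ((hanti (le_of_lt hx)).trans_eq hFa.symm) (hnonneg x)
  have hunique := (hderiv b).unique ((hasDerivAt_const b (0 : ℝ)).congr_of_eventuallyEq hzero)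
  simpa using hunique

/-- The exponential sum `∑ i, c i * exp (ζ i * x)`, as a function of a real variable. -/
noncomputable def expSum {ι : Type*} [Fintype ι] (c ζ : ι → ℂ) (x : ℝ) : ℂ :=
  ∑ i, c i * Complex.exp (ζ i * x)

section ExpSum

variable {ι : Type*} [Fintype ι] {c ζ : ι → ℂ}

theorem contDiff_expSum {n : WithTop ℕ∞} : ContDiff ℝ n (expSum c ζ) := by
  have hlinear : ContDiff ℝ n ((↑) : ℝ → ℂ) := Complex.ofRealCLM.contDiff
  unfold expSum
  fun_prop

theorem hasDerivAt_expSum (c ζ : ι → ℂ) (x : ℝ) :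
    HasDerivAt (expSum c ζ) (expSum (c * ζ) ζ x) x := by
  refine (HasDerivAt.fun_sum fun i _ => (((hasDerivAt_id x).ofReal_comp.const_mul
    (ζ i)).cexp.const_mul (c i))).congr_deriv ?_
  refine Finset.sum_congr rfl fun i _ => ?_
  simp only [id_eq, Complex.ofReal_one, Pi.mul_apply]
  ring

theorem iteratedDeriv_expSum (c ζ : ι → ℂ) (k : ℕ) :
    iteratedDeriv k (expSum c ζ) = expSum (c * ζ ^ k) ζ := by
  induction k with
  | zero => simp
  | succ k ih =>
    rw [iteratedDeriv_succ, ih, pow_succ, ← mul_assoc]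
    exact funext fun x => (hasDerivAt_expSum _ ζ x).deriv

theorem tendsto_expSum_atTop_zero (hre : ∀ i, c i ≠ 0 → (ζ i).re < 0) :
    Tendsto (expSum c ζ) atTop (𝓝 0) := by
  rw [← Finset.sum_const_zero (ι := ι) (s := Finset.univ)]
  refine tendsto_finsetSum _ fun i _ => ?_
  by_cases hi : c i = 0
  · simpa only [hi, zero_mul] using tendsto_const_nhds
  · have hexp : Tendsto (fun x : ℝ => Complex.exp (ζ i * x)) atTop (𝓝 0) := by
      refine Complex.tendsto_exp_nhds_zero_iff.2 ?_
      simpa using tendsto_id.const_mul_atTop_of_neg (hre i hi)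
    simpa using hexp.const_mul (c i)

end ExpSum

theorem lineJet_expSum_zero {m : ℕ} (c ζ : Fin m → ℂ) :
    lineJet m (expSum c ζ) 0 = c ᵥ* vandermonde ζ := by
  ext k
  simp [lineJet, iteratedDeriv_expSum, expSum, vecMul, dotProduct]

theorem eq_zero_of_lineJet_expSum_eq_zero {m : ℕ} {c ζ : Fin m → ℂ} (hζ : Function.Injective ζ)
    {x : ℝ} (hx : lineJet m (expSum c ζ) x = 0) : c = 0 := by
  have hmul : (fun i => c i * Complex.exp (ζ i * x)) = 0 := by
    refine eq_zero_of_forall_pow_sum_mul_pow_eq_zero hζ fun k => ?_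
    have hk := congrFun hx k
    rw [lineJet, iteratedDeriv_expSum] at hk
    exact (Finset.sum_congr rfl fun i _ => mul_right_comm _ _ _).trans hk
  exact funext fun i => (mul_eq_zero.1 (congrFun hmul i)).resolve_right (Complex.exp_ne_zero _)

theorem concomitant_vecMul_vandermonde_im_pos {m : ℕ} (hm : Even m) {c ζ : Fin m → ℂ}
    (hinj : Function.Injective ζ) (hpow : ∀ i, ζ i ^ m = -Complex.I)
    (hre : ∀ i, c i ≠ 0 → (ζ i).re < 0) (hc : c ≠ 0) :
    0 < (concomitant (c ᵥ* vandermonde ζ)).im := by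
  have hode (x : ℝ) : iteratedDeriv m (expSum c ζ) x = -Complex.I * expSum c ζ x := by
    rw [iteratedDeriv_expSum, expSum, expSum, Finset.mul_sum]
    refine Finset.sum_congr rfl fun i _ => ?_
    rw [Pi.mul_apply, Pi.pow_apply, hpow]
    ring
  have hlim : Tendsto (lineJet m (expSum c ζ)) atTop (𝓝 0) := by
    refine tendsto_pi_nhds.2 fun k => ?_
    simp only [lineJet, iteratedDeriv_expSum]
    exact tendsto_expSum_atTop_zero fun i hi => hre i (left_ne_zero_of_mul hi)
  obtain ⟨b, hb_pos, hb⟩ : ∃ b : ℝ, 0 < b ∧ expSum c ζ b ≠ 0 := by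
    by_contra! hzero
    have hnhds : expSum c ζ =ᶠ[𝓝 1] 0 := by
      filter_upwards [Ioi_mem_nhds zero_lt_one] with x hx using hzero x hx
    refine hc (eq_zero_of_lineJet_expSum_eq_zero hinj (x := 1) (funext fun k => ?_))
    exact (hnhds.iteratedDeriv_eq k).trans (by simp)
  rw [← lineJet_expSum_zero]
  exact concomitant_im_pos_of_tendsto_zero hm contDiff_expSum hode hlim hb_pos hb

theorem concomitant_vecMul_vandermonde_im_neg {m : ℕ} (hm : Even m) {c ζ : Fin m → ℂ}
    (hinj : Function.Injective ζ) (hpow : ∀ i, ζ i ^ m = -Complex.I)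
    (hre : ∀ i, c i ≠ 0 → 0 < (ζ i).re) (hc : c ≠ 0) :
    (concomitant (c ᵥ* vandermonde ζ)).im < 0 := by
  -- The reflection `x ↦ -x` multiplies the derivative of order `s` by `(-1) ^ s`.
  have hreflect : c ᵥ* vandermonde (-ζ) =
      (fun s : Fin m => (-1 : ℂ) ^ (s : ℕ)) * (c ᵥ* vandermonde ζ) := by
    ext s
    simp only [vecMul, dotProduct, vandermonde_apply, Pi.neg_apply, Pi.mul_apply,
      Finset.mul_sum, neg_pow (ζ _)]
    exact Finset.sum_congr rfl fun i _ => mul_left_comm _ _ _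
  have hsign (s : Fin m) : (-1 : ℂ) ^ (s.rev : ℕ) * conj ((-1 : ℂ) ^ (s : ℕ)) = -1 := by
    have hodd : Odd ((s.rev : ℕ) + s) := by
      rw [Fin.val_rev]
      grind
    rw [map_pow, map_neg, map_one, ← pow_add, hodd.neg_one_pow]
  have hpos := concomitant_vecMul_vandermonde_im_pos (ζ := -ζ) hm (neg_injective.comp hinj)
    (fun i => by rw [Pi.neg_apply, hm.neg_pow, hpow]) (fun i hi => by simpa using hre i hi) hc
  rw [hreflect, concomitant_mul hsign] at hpos
  simpa using hpos

theorem eq_zero_of_concomitant_im_eq {m : ℕ} (hm : Even m) {c d ζ : Fin m → ℂ}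
    (hinj : Function.Injective ζ) (hpow : ∀ i, ζ i ^ m = -Complex.I)
    (hc : ∀ i, c i ≠ 0 → (ζ i).re < 0) (hd : ∀ i, d i ≠ 0 → 0 < (ζ i).re)
    (heq : (concomitant (c ᵥ* vandermonde ζ)).im = (concomitant (d ᵥ* vandermonde ζ)).im) :
    c = 0 ∧ d = 0 := by
  have hpos := concomitant_vecMul_vandermonde_im_pos hm hinj hpow hc
  have hneg := concomitant_vecMul_vandermonde_im_neg hm hinj hpow hd
  by_cases hc0 : c = 0
  · refine ⟨hc0, by_contra fun hd0 => (hneg hd0).ne ?_⟩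
    rw [← heq, hc0, zero_vecMul, concomitant_zero, Complex.zero_im]
  · refine absurd heq (ne_of_gt ?_)
    by_cases hd0 : d = 0
    · simpa only [hd0, zero_vecMul, concomitant_zero, Complex.zero_im] using hpos hc0
    · exact (hneg hd0).trans (hpos hc0)

/-! ### Principal parts of normalized conditions -/

section LinearAlgebra

variable {R K ι κ : Type*} [CommRing R] [Field K]

theorem linearIndependent_row_fromCols_iff [Fintype ι] {M N : Matrix ι κ R} :
    LinearIndependent R (fromCols M N).row ↔ ∀ g, g ᵥ* M = 0 → g ᵥ* N = 0 → g = 0 := by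
  rw [← vecMul_injective_iff, ← coe_vecMulLinear, injective_iff_map_eq_zero]
  refine forall_congr' fun g => ?_
  rw [vecMulLinear_apply, vecMul_fromCols, ← Sum.elim_zero_zero, Sum.elim_eq_iff, and_imp]

theorem linearIndependent_pair_subtype_iff [Fintype ι] {p : ι → Prop} [DecidablePred p]
    {α β : ι → R} :
    LinearIndependent R (fun j : {j // p j} => ![α j, β j]) ↔
      ∀ g : ι → R, ∑ j with p j, g j * α j = 0 → ∑ j with p j, g j * β j = 0 →
        ∀ j, p j → g j = 0 := by
  change LinearIndepOn R (fun j => ![α j, β j]) {j | p j} ↔ _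
  rw [← Finset.coe_filter_univ, linearIndepOn_finset_iff]
  refine forall_congr' fun g => ?_
  rw [funext_iff, Fin.forall_fin_two, and_imp]
  simp [Finset.sum_apply]

theorem exists_mul_eq_one_of_linearIndependent_row [Finite ι] [DecidableEq ι] [Fintype κ]
    {M : Matrix ι κ K} (hM : LinearIndependent K M.row) : ∃ S : Matrix κ ι K, M * S = 1 := by
  have := Fintype.ofFinite ι
  rw [← mulVec_surjective_iff_exists_right_inverse]
  have hrange : LinearMap.range M.mulVecLin = ⊤ := by
    refine Submodule.eq_top_of_finrank_eq ?_
    rw [Module.finrank_fintype_fun_eq_card]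
    exact hM.rank_matrix
  exact LinearMap.range_eq_top.1 hrange

theorem exists_continuous_mulVec_eq_zero [Finite ι] [DecidableEq ι] [Fintype κ]
    [TopologicalSpace R] [IsTopologicalRing R] {X : Type*} [TopologicalSpace X]
    {P : X → Matrix ι κ R} (hP : Continuous P) {t₀ : X}
    {S : Matrix κ ι R} (hS : P t₀ * S = 1) {x : κ → R} (hx : P t₀ *ᵥ x = 0) :
    ∃ z : X → κ → R, Continuous z ∧ (∀ t, P t *ᵥ z t = 0) ∧ z t₀ = x := by
  have := Fintype.ofFinite ι
  have hPS : Continuous fun t => P t * S := hP.matrix_mul continuous_const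
  -- The projection `1 - S (P t S)⁻¹ (P t)` onto the kernel, cleared of denominators.
  refine ⟨fun t => (P t * S).det • x - S *ᵥ ((P t * S).adjugate *ᵥ (P t *ᵥ x)), ?_, fun t => ?_, ?_⟩
  · exact (hPS.matrix_det.smul continuous_const).sub (continuous_const.matrix_mulVec
      (hPS.matrix_adjugate.matrix_mulVec (hP.matrix_mulVec continuous_const)))
  · rw [mulVec_sub, mulVec_smul, mulVec_mulVec, mulVec_mulVec, mul_adjugate, smul_mulVec,
      one_mulVec, sub_self]
  · simp only [hS, hx, det_one, one_smul, mulVec_zero, sub_zero]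

end LinearAlgebra

section PrincipalPart

variable {ι R : Type*} {m : ℕ}

/-- The `j`-th condition with coefficient matrix `C` contains no derivative of order above `k j`.
A boundary condition has one such matrix for each end point. -/
def HasOrderLE [Zero R] (k : ι → Fin m) (C : Matrix ι (Fin m) R) : Prop :=
  ∀ j s, k j < s → C j s = 0

/-- The terms of highest order `k j` in conditions with coefficient matrix `C`. -/
def principalPart [Zero R] (k : ι → Fin m) (C : Matrix ι (Fin m) R) : Matrix ι (Fin m) R :=
  of fun j => Pi.single (k j) (C j (k j))

variable [CommSemiring R]

/-- The coefficient matrix of conditions of orders `k` after the change of variables `x ↦ t x`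
(and division of the `j`-th condition by a power of `t`). At `t = 0` only the principal part is
left. The truncated subtraction does no harm, since only matrices with `HasOrderLE k C` are used. -/
def dilatedCoeff (k : ι → Fin m) (C : Matrix ι (Fin m) R) (t : R) : Matrix ι (Fin m) R :=
  of fun j s => t ^ ((k j : ℕ) - s) * C j s

variable {k : ι → Fin m} {C : Matrix ι (Fin m) R}

theorem principalPart_mulVec (v : Fin m → R) :
    principalPart k C *ᵥ v = fun j => C j (k j) * v (k j) :=
  funext fun j => single_dotProduct v (C j (k j)) (k j)

theorem vecMul_principalPart [Fintype ι] (g : ι → R) (r : Fin m) :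
    (g ᵥ* principalPart k C) r = ∑ j with k j = r, g j * C j r := by
  rw [Finset.sum_filter]
  refine Finset.sum_congr rfl fun j _ => ?_
  simp only [principalPart, of_apply, Pi.single_apply, mul_ite, mul_zero, eq_comm (a := r)]
  split_ifs with h
  · rw [h]
  · rfl

theorem continuous_dilatedCoeff [TopologicalSpace R] [ContinuousMul R] :
    Continuous (dilatedCoeff k C) :=
  continuous_matrix fun _ _ => (continuous_id.pow _).mul continuous_const

theorem dilatedCoeff_zero (hC : HasOrderLE k C) :
    dilatedCoeff k C 0 = principalPart k C := by
  ext j s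
  rcases lt_trichotomy (k j) s with hs | rfl | hs
  · simp [dilatedCoeff, principalPart, hC j s hs, hs.ne']
  · simp [dilatedCoeff, principalPart]
  · have hpos : (k j : ℕ) - s ≠ 0 := Nat.sub_ne_zero_of_lt hs
    simp [dilatedCoeff, principalPart, hs.ne, hpos]

theorem mulVec_pow_rev_mul (hC : HasOrderLE k C) (t : R) (v : Fin m → R) :
    C *ᵥ (fun s => t ^ (s.rev : ℕ) * v s) =
      (fun j => t ^ ((k j).rev : ℕ)) * dilatedCoeff k C t *ᵥ v := by
  ext j
  simp only [mulVec, dotProduct, Pi.mul_apply, Finset.mul_sum, dilatedCoeff, of_apply]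
  refine Finset.sum_congr rfl fun s _ => ?_
  rcases lt_or_ge (k j) s with hs | hs
  · simp only [hC j s hs, zero_mul, mul_zero]
  · have hexponent : (s.rev : ℕ) = (k j).rev + ((k j : ℕ) - s) := by
      rw [Fin.val_rev, Fin.val_rev]
      omega
    rw [hexponent, pow_add]
    ring

end PrincipalPart

theorem concomitant_pow_rev_mul {m : ℕ} (t : ℝ) (v : Fin m → ℂ) :
    concomitant ((fun s : Fin m => (t : ℂ) ^ (s.rev : ℕ)) * v) =
      ((t ^ (m - 1) : ℝ) : ℂ) * concomitant v := by
  refine concomitant_mul (fun s => ?_) v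
  have hexponent : (s : ℕ) + s.rev = m - 1 := by
    rw [Fin.val_rev]
    omega
  rw [Fin.rev_rev, map_pow, Complex.conj_ofReal, ← pow_add, hexponent, Complex.ofReal_pow]

theorem concomitant_neg_upper_half {m : ℕ} (hm : Even m) (v : Fin m → ℂ) :
    concomitant ((fun s : Fin m => if s < s.rev then 1 else -1) * v) = -concomitant v := by
  refine (concomitant_mul (fun s => ?_) v).trans (neg_one_mul _)
  have hne : s ≠ s.rev := fun h => by
    have := congrArg Fin.val h
    grind
  rcases hne.lt_or_gt with hs | hs <;> simp [hs, hs.not_gt]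

namespace IsNormalizedBC

variable {m : ℕ} {C D : Matrix (Fin m) (Fin m) ℂ} {k : Fin m → Fin m}

theorem hasOrderLE_left (h : IsNormalizedBC C D k) : HasOrderLE k C :=
  fun j s hs => (h.order_le j s hs).1

theorem hasOrderLE_right (h : IsNormalizedBC C D k) : HasOrderLE k D :=
  fun j s hs => (h.order_le j s hs).2

theorem linearIndependent_principalPart (h : IsNormalizedBC C D k) :
    LinearIndependent ℂ (fromCols (principalPart k C) (principalPart k D)).row := by
  refine linearIndependent_row_fromCols_iff.2 fun g hC hD => funext fun j => ?_
  refine linearIndependent_pair_subtype_iff (α := fun i => C i (k j)) (β := fun i => D i (k j))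
    |>.1 (h.leading (k j)) g ?_ ?_ j rfl
  · rw [← vecMul_principalPart, hC, Pi.zero_apply]
  · rw [← vecMul_principalPart, hD, Pi.zero_apply]

theorem exists_continuous_dilatedCoeff_mulVec_eq_zero (h : IsNormalizedBC C D k)
    {u w : Fin m → ℂ} (huw : principalPart k C *ᵥ u + principalPart k D *ᵥ w = 0) :
    ∃ u' w' : ℝ → Fin m → ℂ, Continuous u' ∧ Continuous w' ∧ u' 0 = u ∧ w' 0 = w ∧
      ∀ t : ℝ, dilatedCoeff k C t *ᵥ u' t + dilatedCoeff k D t *ᵥ w' t = 0 := by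
  let P : ℝ → Matrix (Fin m) (Fin m ⊕ Fin m) ℂ :=
    fun t => fromCols (dilatedCoeff k C t) (dilatedCoeff k D t)
  have hP : Continuous P := by
    refine continuous_matrix fun j s => ?_
    rcases s with s | s
    · exact (continuous_dilatedCoeff.comp Complex.continuous_ofReal).matrix_elem j s
    · exact (continuous_dilatedCoeff.comp Complex.continuous_ofReal).matrix_elem j s
  have hP_zero : P 0 = fromCols (principalPart k C) (principalPart k D) := by
    simp only [P, Complex.ofReal_zero, dilatedCoeff_zero h.hasOrderLE_left,
      dilatedCoeff_zero h.hasOrderLE_right]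
  obtain ⟨S, hS⟩ := exists_mul_eq_one_of_linearIndependent_row h.linearIndependent_principalPart
  have huw_P : P 0 *ᵥ Sum.elim u w = 0 := by rw [hP_zero, fromCols_mulVec_sumElim, huw]
  obtain ⟨z, hz, hker, hz_zero⟩ := exists_continuous_mulVec_eq_zero hP (hP_zero ▸ hS) huw_P
  refine ⟨fun t => z t ∘ Sum.inl, fun t => z t ∘ Sum.inr, by fun_prop, by fun_prop, ?_, ?_,
    fun t => ?_⟩
  · simp only [hz_zero, Sum.elim_comp_inl]
  · simp only [hz_zero, Sum.elim_comp_inr]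
  · rw [← fromCols_mulVec_sumElim, Sum.elim_comp_inl_inr, hker]

theorem concomitant_principalPart_nonneg (h : IsNormalizedBC C D k) {ε : ℝ}
    (hnonneg : ∀ u w, C *ᵥ u + D *ᵥ w = 0 → 0 ≤ ε * ((concomitant w).im - (concomitant u).im))
    {u w : Fin m → ℂ} (huw : principalPart k C *ᵥ u + principalPart k D *ᵥ w = 0) :
    0 ≤ ε * ((concomitant w).im - (concomitant u).im) := by
  obtain ⟨u', w', hu', hw', rfl, rfl, hker⟩ := h.exists_continuous_dilatedCoeff_mulVec_eq_zero huw
  let f : ℝ → ℝ := fun t => ε * ((concomitant (w' t)).im - (concomitant (u' t)).im)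
  have hf : Continuous f := continuous_const.mul
    ((Complex.continuous_im.comp (continuous_concomitant.comp hw')).sub
      (Complex.continuous_im.comp (continuous_concomitant.comp hu')))
  have hf_nonneg (t : ℝ) (ht : 0 < t) : 0 ≤ f t := by
    have hscaled := hnonneg ((fun s => (t : ℂ) ^ (s.rev : ℕ)) * u' t)
      ((fun s => (t : ℂ) ^ (s.rev : ℕ)) * w' t) <| by
        rw [Pi.mul_def, Pi.mul_def, mulVec_pow_rev_mul h.hasOrderLE_left,
          mulVec_pow_rev_mul h.hasOrderLE_right, ← mul_add, hker, mul_zero]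
    rw [concomitant_pow_rev_mul, concomitant_pow_rev_mul, Complex.im_ofReal_mul,
      Complex.im_ofReal_mul, ← mul_sub, mul_left_comm] at hscaled
    exact nonneg_of_mul_nonneg_right hscaled (pow_pos ht _)
  exact ge_of_tendsto (hf.continuousAt.tendsto.mono_left nhdsWithin_le_nhds)
    (eventually_nhdsWithin_of_forall (s := Ioi 0) hf_nonneg)

theorem concomitant_principalPart_eq (h : IsNormalizedBC C D k) (hm : Even m) {ε : ℝ}
    (hε : ε ≠ 0)
    (hnonneg : ∀ u w, C *ᵥ u + D *ᵥ w = 0 → 0 ≤ ε * ((concomitant w).im - (concomitant u).im))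
    {u w : Fin m → ℂ} (huw : principalPart k C *ᵥ u + principalPart k D *ᵥ w = 0) :
    (concomitant u).im = (concomitant w).im := by
  let σ : Fin m → ℂ := fun s => if s < s.rev then 1 else -1
  -- Each principal condition involves derivatives of a single order only.
  have hsign : principalPart k C *ᵥ (σ * u) + principalPart k D *ᵥ (σ * w) = 0 := by
    ext j
    have hj := congrFun huw j
    simp only [principalPart_mulVec, Pi.add_apply, Pi.mul_apply, Pi.zero_apply] at hj ⊢
    linear_combination σ (k j) * hj
  have hpos := h.concomitant_principalPart_nonneg hnonneg huw
  have hneg := h.concomitant_principalPart_nonneg hnonneg hsign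
  simp only [σ, concomitant_neg_upper_half hm, Complex.neg_im] at hneg
  have hzero : ε * ((concomitant w).im - (concomitant u).im) = 0 := by linarith
  linarith [(mul_eq_zero.1 hzero).resolve_left hε]

end IsNormalizedBC

theorem EquivalentBC.mulVec_eq_zero {m : ℕ} {A B C D : Matrix (Fin m) (Fin m) ℂ}
    (h : EquivalentBC A B C D) {u w : Fin m → ℂ} (huw : C *ᵥ u + D *ᵥ w = 0) :
    A *ᵥ u + B *ᵥ w = 0 := by
  obtain ⟨G, hG, rfl, rfl⟩ := h
  apply mulVec_injective_iff_isUnit.2 hG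
  rw [mulVec_add, mulVec_mulVec, mulVec_mulVec, huw, mulVec_zero]

/-! ### The ordered roots of `-1` -/

theorem exists_apply_eq_of_pow_eq {R : Type*} [CommRing R] [IsDomain R] {m : ℕ} (hm : 0 < m)
    {ω : Fin m → R} (hinj : Function.Injective ω) {a : R} (hpow : ∀ i, ω i ^ m = a) {z : R}
    (hz : z ^ m = a) : ∃ i, ω i = z := by
  classical
  have hsub : Finset.univ.image ω ⊆ (Polynomial.nthRoots m a).toFinset := by
    simp [Finset.subset_iff, Polynomial.mem_nthRoots hm, hpow]
  have heq : Finset.univ.image ω = (Polynomial.nthRoots m a).toFinset := by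
    refine Finset.eq_of_subset_of_card_le hsub ?_
    rw [Finset.card_image_of_injective _ hinj, Finset.card_univ, Fintype.card_fin]
    exact (Multiset.toFinset_card_le _).trans (Polynomial.card_nthRoots m a)
  have hmem : z ∈ Finset.univ.image ω := by
    rwa [heq, Multiset.mem_toFinset, Polynomial.mem_nthRoots hm]
  simpa using hmem

theorem apply_rev_eq_neg_of_strictMono {α : Type*} [AddCommGroup α] [LinearOrder α]
    [IsOrderedAddMonoid α] {m : ℕ} {f : Fin m → α} (hf : StrictMono f)
    (hneg : ∀ i, ∃ j, f j = -f i) (l : Fin m) : f l.rev = -f l := by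
  let g : Fin m → α := fun i => -f i.rev
  have hg : StrictMono g := fun i j hij => neg_lt_neg (hf (Fin.rev_lt_rev.2 hij))
  have hrange : range g = range f := by
    refine Subset.antisymm (range_subset_iff.2 fun i => hneg i.rev) (range_subset_iff.2 fun i => ?_)
    obtain ⟨j, hj⟩ := hneg i
    exact ⟨j.rev, by simp only [g, Fin.rev_rev, hj, neg_neg]⟩
  rw [← congrFun ((hg.range_inj hf).1 hrange) l, neg_neg]

theorem exp_I_mul_pi_div_two_mul_pow {m : ℕ} (hm : m ≠ 0) :
    Complex.exp (Complex.I * Real.pi / (2 * m)) ^ m = Complex.I := by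
  have hexponent : (m : ℂ) * (Complex.I * Real.pi / (2 * m)) = Real.pi / 2 * Complex.I := by
    have : (m : ℂ) ≠ 0 := Nat.cast_ne_zero.2 hm
    field_simp
  rw [← Complex.exp_nat_mul, hexponent, Complex.exp_pi_div_two_mul_I]

/-- The numbers `ω_l * e^(iπ/(2m))`. If the `ω_l` are the roots of `-1`, these are the exponents
of the exponential solutions of `y^(m) = -iy`. -/
noncomputable def rotatedRoots {m : ℕ} (ω : Fin m → ℂ) (l : Fin m) : ℂ :=
  ω l * Complex.exp (Complex.I * Real.pi / (2 * m))

namespace IsOrderedRoots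

variable {m : ℕ} {ω : Fin m → ℂ}

theorem injective (hω : IsOrderedRoots m ω) : Function.Injective ω :=
  fun i j hij => hω.2.injective (by simp only [hij])

theorem rotatedRoots_injective (hω : IsOrderedRoots m ω) : Function.Injective (rotatedRoots ω) :=
  (mul_left_injective₀ (Complex.exp_ne_zero _)).comp hω.injective

theorem rotatedRoots_pow (hω : IsOrderedRoots m ω) (l : Fin m) :
    rotatedRoots ω l ^ m = -Complex.I := by
  rw [rotatedRoots, mul_pow, hω.1, exp_I_mul_pi_div_two_mul_pow l.pos.ne', neg_one_mul]

theorem re_rotatedRoots_rev (hω : IsOrderedRoots m ω) (hm : Even m) (l : Fin m) :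
    (rotatedRoots ω l.rev).re = -(rotatedRoots ω l).re := by
  refine apply_rev_eq_neg_of_strictMono hω.2 (fun i => ?_) l
  obtain ⟨j, hj⟩ := exists_apply_eq_of_pow_eq i.pos hω.injective hω.1
    (z := -ω i) (by rw [hm.neg_pow, hω.1])
  exact ⟨j, by rw [hj, neg_mul, Complex.neg_re]⟩

theorem re_rotatedRoots_neg (hω : IsOrderedRoots m ω) (hm : Even m) {l : Fin m}
    (hl : l < l.rev) : (rotatedRoots ω l).re < 0 := by
  have hlt : (rotatedRoots ω l).re < (rotatedRoots ω l.rev).re := hω.2 hl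
  rw [hω.re_rotatedRoots_rev hm] at hlt
  linarith

theorem re_rotatedRoots_pos (hω : IsOrderedRoots m ω) (hm : Even m) {l : Fin m}
    (hl : l.rev < l) : 0 < (rotatedRoots ω l).re := by
  have hlt : (rotatedRoots ω l.rev).re < (rotatedRoots ω l).re := hω.2 hl
  rw [hω.re_rotatedRoots_rev hm] at hlt
  linarith

end IsOrderedRoots

/-! ### The regularity determinant -/

/-- The matrix with columns `α_j * ω_l ^ k_j` in the first half and `β_j * ω_l ^ k_j` in the second
half. Its determinant is the coefficient `θ₋₁` of the regularity determinant. -/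
def leadingMatrix {m : ℕ} (α β : Fin m → ℂ) (k : Fin m → Fin m) (ω : Fin m → ℂ) :
    Matrix (Fin m) (Fin m) ℂ :=
  of fun j l => (if l < l.rev then α j else β j) * ω l ^ (k j : ℕ)

theorem principalPart_mulVec_vecMul_vandermonde {m : ℕ} (C D : Matrix (Fin m) (Fin m) ℂ)
    (k : Fin m → Fin m) (ω c : Fin m → ℂ) (μ : ℂ) :
    principalPart k C *ᵥ ((fun l => if l < l.rev then c l else 0) ᵥ*
          vandermonde fun l => ω l * μ) +
        principalPart k D *ᵥ ((fun l => if l < l.rev then 0 else c l) ᵥ*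
          vandermonde fun l => ω l * μ) =
      (fun j => μ ^ (k j : ℕ)) *
        leadingMatrix (fun j => C j (k j)) (fun j => D j (k j)) k ω *ᵥ c := by
  ext j
  simp only [principalPart_mulVec, Pi.add_apply, Pi.mul_apply, vecMul, mulVec, dotProduct,
    vandermonde_apply, leadingMatrix, of_apply, Finset.mul_sum, ← Finset.sum_add_distrib]
  refine Finset.sum_congr rfl fun l _ => ?_
  split_ifs <;> ring

theorem det_leadingMatrix_ne_zero {m : ℕ} (hm : Even m) {C D : Matrix (Fin m) (Fin m) ℂ}
    {k : Fin m → Fin m} {ω : Fin m → ℂ} (hω : IsOrderedRoots m ω)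
    (heq : ∀ u w, principalPart k C *ᵥ u + principalPart k D *ᵥ w = 0 →
      (concomitant u).im = (concomitant w).im) :
    (leadingMatrix (fun j => C j (k j)) (fun j => D j (k j)) k ω).det ≠ 0 := by
  intro hdet
  obtain ⟨c, hc_ne, hc⟩ := exists_mulVec_eq_zero_iff.2 hdet
  have hconc := heq _ _ ((principalPart_mulVec_vecMul_vandermonde C D k ω c
    (Complex.exp (Complex.I * Real.pi / (2 * m)))).trans (by rw [hc, mul_zero]))
  have hrev_lt {l : Fin m} (hl : ¬l < l.rev) : l.rev < l := by
    have hval : (l.rev : ℕ) ≤ l := not_lt.1 hl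
    rw [Fin.val_rev] at hval
    rw [Fin.lt_def, Fin.val_rev]
    grind
  obtain ⟨hdecay, hgrow⟩ := eq_zero_of_concomitant_im_eq hm hω.rotatedRoots_injective
    hω.rotatedRoots_pow (fun l hl => hω.re_rotatedRoots_neg hm (by simp_all))
    (fun l hl => hω.re_rotatedRoots_pos hm (hrev_lt (by simp_all))) hconc
  refine hc_ne (funext fun l => ?_)
  by_cases hl : l < l.rev
  · simpa [hl] using congrFun hdecay l
  · simpa [hl] using congrFun hgrow l

theorem det_updateCol_updateCol_add_smul {ι R : Type*} [Fintype ι] [DecidableEq ι] [CommRing R]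
    (M : Matrix ι ι R) {p q : ι} (hpq : p ≠ q) (x x' y y' : ι → R) (s t : R) :
    ((M.updateCol p (x + s • x')).updateCol q (y + t • y')).det =
      ((M.updateCol p x).updateCol q y).det + t * ((M.updateCol p x).updateCol q y').det +
        s * ((M.updateCol p x').updateCol q y).det +
        s * t * ((M.updateCol p x').updateCol q y').det := by
  have det_left (z : ι → R) : ((M.updateCol p (x + s • x')).updateCol q z).det =
      ((M.updateCol p x).updateCol q z).det + s * ((M.updateCol p x').updateCol q z).det := by
    rw [updateCol_comm _ hpq, updateCol_comm _ hpq, updateCol_comm _ hpq, det_updateCol_add,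
      det_updateCol_smul]
  rw [det_updateCol_add, det_updateCol_smul, det_left, det_left]
  ring

theorem regularityMatrix_eq_updateCol {n : ℕ} (α β : Fin (2 * n) → ℂ)
    (k : Fin (2 * n) → Fin (2 * n)) (ω : Fin (2 * n) → ℂ) {p q : Fin (2 * n)}
    (hp : (p : ℕ) + 1 = n) (hq : (q : ℕ) = n) (s : ℂ) :
    regularityMatrix n α β k ω s =
      ((leadingMatrix α β k ω).updateCol p
          ((fun j => α j * ω p ^ (k j : ℕ)) + s • fun j => β j * ω p ^ (k j : ℕ))).updateCol q
        ((fun j => α j * ω q ^ (k j : ℕ)) + s⁻¹ • fun j => β j * ω q ^ (k j : ℕ)) := by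
  ext j l
  rcases eq_or_ne l q with rfl | hlq
  · simp [regularityMatrix, hq]
    ring
  rcases eq_or_ne l p with rfl | hlp
  · simp [regularityMatrix, hlq, hp]
    ring
  have hlq_val : (l : ℕ) ≠ n := fun h => hlq (Fin.ext (h.trans hq.symm))
  have hlp_val : (l : ℕ) + 1 ≠ n := fun h => hlp (Fin.ext (by omega))
  have hhalf : l < l.rev ↔ (l : ℕ) + 1 < n := by
    rw [Fin.lt_def, Fin.val_rev]
    omega
  simp [regularityMatrix, leadingMatrix, hlq, hlp, hlq_val, hlp_val, hhalf]

theorem leadingMatrix_eq_updateCol {n : ℕ} (α β : Fin (2 * n) → ℂ)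
    (k : Fin (2 * n) → Fin (2 * n)) (ω : Fin (2 * n) → ℂ) {p q : Fin (2 * n)}
    (hp : (p : ℕ) < n) (hq : n ≤ (q : ℕ)) :
    leadingMatrix α β k ω =
      ((leadingMatrix α β k ω).updateCol p fun j => α j * ω p ^ (k j : ℕ)).updateCol q
        fun j => β j * ω q ^ (k j : ℕ) := by
  have hp_half : p < p.rev := by
    rw [Fin.lt_def, Fin.val_rev]
    omega
  have hq_half : ¬q < q.rev := by
    rw [Fin.lt_def, Fin.val_rev]
    omega
  ext j l
  simp only [updateCol_apply]
  split_ifs with hlq hlp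
  · simp [leadingMatrix, hlq, hq_half]
  · simp [leadingMatrix, hlp, hp_half]
  · rfl

theorem exists_det_regularityMatrix_eq {n : ℕ} (hn : 0 < n) (α β : Fin (2 * n) → ℂ)
    (k : Fin (2 * n) → Fin (2 * n)) (ω : Fin (2 * n) → ℂ) :
    ∃ θzero θpos : ℂ, ∀ s : ℂ, s ≠ 0 →
      (leadingMatrix α β k ω).det / s + θzero + θpos * s = (regularityMatrix n α β k ω s).det := by
  let p : Fin (2 * n) := ⟨n - 1, by omega⟩
  let q : Fin (2 * n) := ⟨n, by omega⟩
  have hp : (p : ℕ) + 1 = n := Nat.sub_add_cancel hn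
  have hpq : p ≠ q := Fin.ne_of_val_ne (by simp only [q]; omega)
  let a (l : Fin (2 * n)) : Fin (2 * n) → ℂ := fun j => α j * ω l ^ (k j : ℕ)
  let b (l : Fin (2 * n)) : Fin (2 * n) → ℂ := fun j => β j * ω l ^ (k j : ℕ)
  let d (x y : Fin (2 * n) → ℂ) : ℂ := (((leadingMatrix α β k ω).updateCol p x).updateCol q y).det
  refine ⟨d (a p) (a q) + d (b p) (b q), d (b p) (a q), fun s hs => ?_⟩
  rw [regularityMatrix_eq_updateCol α β k ω hp (q := q) rfl, det_updateCol_updateCol_add_smul _ hpq,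
    ← leadingMatrix_eq_updateCol α β k ω (Nat.lt_of_succ_le hp.le) le_rfl, mul_inv_cancel₀ hs]
  simp only [d, a, b]
  ring

/-! ### Existence of normalized conditions -/

theorem IndependentBC.eq_zero_of_vecMul_eq_zero {m : ℕ} {A B : Matrix (Fin m) (Fin m) ℂ}
    (h : IndependentBC A B) {g : Fin m → ℂ} (hA : g ᵥ* A = 0) (hB : g ᵥ* B = 0) : g = 0 :=
  linearIndependent_row_fromCols_iff.1 h g hA hB

namespace EquivalentBC

variable {m : ℕ} {A B C D : Matrix (Fin m) (Fin m) ℂ}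

theorem refl (A B : Matrix (Fin m) (Fin m) ℂ) : EquivalentBC A B A B :=
  ⟨1, isUnit_one, (one_mul A).symm, (one_mul B).symm⟩

theorem trans (h : EquivalentBC A B C D) {E F : Matrix (Fin m) (Fin m) ℂ}
    (h' : EquivalentBC C D E F) : EquivalentBC A B E F := by
  obtain ⟨G, hG, rfl, rfl⟩ := h
  obtain ⟨H, hH, rfl, rfl⟩ := h'
  exact ⟨H * G, hH.mul hG, (mul_assoc _ _ _).symm, (mul_assoc _ _ _).symm⟩

theorem independentBC (h : EquivalentBC A B C D) (hind : IndependentBC A B) :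
    IndependentBC C D := by
  obtain ⟨G, hG, rfl, rfl⟩ := h
  refine linearIndependent_row_fromCols_iff.2 fun g hA hB => ?_
  rw [← vecMul_vecMul] at hA hB
  refine vecMul_injective_of_isUnit hG ?_
  simp only [hind.eq_zero_of_vecMul_eq_zero hA hB, zero_vecMul]

theorem updateRow (A B : Matrix (Fin m) (Fin m) ℂ) {c : Fin m → ℂ} {i : Fin m} (hc : c i ≠ 0) :
    EquivalentBC A B (A.updateRow i (c ᵥ* A)) (B.updateRow i (c ᵥ* B)) := by
  refine ⟨(1 : Matrix (Fin m) (Fin m) ℂ).updateRow i c, ?_, ?_, ?_⟩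
  · have hdet := det_updateRow_sum (1 : Matrix (Fin m) (Fin m) ℂ) i c
    rw [← vecMul_eq_sum, vecMul_one, det_one, smul_eq_mul, mul_one] at hdet
    rwa [isUnit_iff_isUnit_det, hdet, isUnit_iff_ne_zero]
  · rw [updateRow_mul, one_mul]
  · rw [updateRow_mul, one_mul]

theorem submatrix (A B : Matrix (Fin m) (Fin m) ℂ) (σ : Equiv.Perm (Fin m)) :
    EquivalentBC A B (A.submatrix σ id) (B.submatrix σ id) := by
  exact ⟨(1 : Matrix (Fin m) (Fin m) ℂ).submatrix σ (Equiv.refl _),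
    (isUnit_submatrix_equiv _ _).2 isUnit_one, (one_submatrix_mul σ (Equiv.refl _) A).symm,
    (one_submatrix_mul σ (Equiv.refl _) B).symm⟩

end EquivalentBC

namespace HasOrderLE

variable {ι R : Type*} {m : ℕ} {k : ι → Fin m} {C : Matrix ι (Fin m) R}

theorem of_forall_le [Zero R] (hk : ∀ j s, s ≤ k j) : HasOrderLE k C :=
  fun j s hs => absurd (hk j s) hs.not_ge

theorem vecMul_apply_eq_zero [Fintype ι] [NonUnitalNonAssocSemiring R] (hC : HasOrderLE k C)
    {c : ι → R} {r : Fin m} (hc : ∀ j, k j ≠ r → c j = 0) (hr : ∑ j with k j = r, c j * C j r = 0)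
    {s : Fin m} (hs : r ≤ s) : (c ᵥ* C) s = 0 := by
  rcases hs.eq_or_lt with rfl | hlt
  · rw [← hr, vecMul, dotProduct]
    refine (Finset.sum_filter_of_ne fun j _ hj => ?_).symm
    exact not_imp_comm.1 (hc j) (left_ne_zero_of_mul hj)
  · rw [vecMul, dotProduct]
    refine Finset.sum_eq_zero fun j _ => ?_
    by_cases hj : k j = r
    · rw [hC j s (hj ▸ hlt), mul_zero]
    · rw [hc j hj, zero_mul]

theorem updateRow [DecidableEq ι] [Zero R] (hC : HasOrderLE k C) {i : ι} {r : Fin m}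
    {v : Fin m → R} (hv : ∀ s, r < s → v s = 0) :
    HasOrderLE (Function.update k i r) (C.updateRow i v) := by
  intro j s hs
  rcases eq_or_ne j i with rfl | hj
  · rw [Function.update_self] at hs
    rw [updateRow_self, hv s hs]
  · rw [Function.update_of_ne hj] at hs
    rw [updateRow_ne hj, hC j s hs]

end HasOrderLE

theorem IndependentBC.exists_equivalentBC_lt {m : ℕ} {C D : Matrix (Fin m) (Fin m) ℂ}
    {k : Fin m → Fin m} (hind : IndependentBC C D) (hC : HasOrderLE k C) (hD : HasOrderLE k D)
    {r : Fin m} (hdep : ¬LinearIndependent ℂ (fun j : {j // k j = r} => ![C j r, D j r])) :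
    ∃ C' D' k', EquivalentBC C D C' D' ∧ HasOrderLE k' C' ∧ HasOrderLE k' D' ∧ k' < k := by
  rw [linearIndependent_pair_subtype_iff (α := fun j => C j r) (β := fun j => D j r)] at hdep
  push Not at hdep
  obtain ⟨g, hgC, hgD, i, hi, hgi⟩ := hdep
  let c : Fin m → ℂ := fun j => if k j = r then g j else 0
  have hc_of_ne (j : Fin m) (hj : k j ≠ r) : c j = 0 := if_neg hj
  have hci : c i ≠ 0 := by rwa [show c i = g i from if_pos hi]
  have hsum (f : Fin m → ℂ) : ∑ j with k j = r, c j * f j = ∑ j with k j = r, g j * f j :=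
    Finset.sum_congr rfl fun j hj => by rw [show c j = g j from if_pos (Finset.mem_filter.1 hj).2]
  have hcC {s : Fin m} : r ≤ s → (c ᵥ* C) s = 0 :=
    hC.vecMul_apply_eq_zero hc_of_ne ((hsum fun j => C j r).trans hgC)
  have hcD {s : Fin m} : r ≤ s → (c ᵥ* D) s = 0 :=
    hD.vecMul_apply_eq_zero hc_of_ne ((hsum fun j => D j r).trans hgD)
  have hr : (r : ℕ) ≠ 0 := by
    intro hr
    have hle (s : Fin m) : r ≤ s := Fin.le_def.2 (hr ▸ Nat.zero_le _)
    have hc_zero := hind.eq_zero_of_vecMul_eq_zero (funext fun s => hcC (hle s))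
      (funext fun s => hcD (hle s))
    exact hci (congrFun hc_zero i)
  let r' : Fin m := ⟨r - 1, by omega⟩
  have hr'_lt : r' < r := Fin.lt_def.2 (Nat.sub_one_lt hr)
  have hle {s : Fin m} (hs : r' < s) : r ≤ s := Nat.le_of_pred_lt hs
  exact ⟨_, _, Function.update k i r', .updateRow C D hci, hC.updateRow fun s hs => hcC (hle hs),
    hD.updateRow fun s hs => hcD (hle hs), update_lt_self_iff.2 (hi ▸ hr'_lt)⟩

theorem IndependentBC.exists_equivalentBC_linearIndependent {m : ℕ}
    {A B : Matrix (Fin m) (Fin m) ℂ} (hind : IndependentBC A B) :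
    ∃ C D k, EquivalentBC A B C D ∧ HasOrderLE k C ∧ HasOrderLE k D ∧
      ∀ r, LinearIndependent ℂ (fun j : {j // k j = r} => ![C j r, D j r]) := by
  obtain ⟨k, ⟨C, D, hequiv, hC, hD⟩, hmin⟩ := exists_minimal_of_wellFoundedLT
    (fun k : Fin m → Fin m => ∃ C D, EquivalentBC A B C D ∧ HasOrderLE k C ∧ HasOrderLE k D)
    ⟨fun j => ⟨m - 1, Nat.sub_one_lt j.pos.ne'⟩, A, B, .refl A B,
      .of_forall_le fun _ s => Nat.le_sub_one_of_lt s.2,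
      .of_forall_le fun _ s => Nat.le_sub_one_of_lt s.2⟩
  refine ⟨C, D, k, hequiv, hC, hD, fun r => by_contra fun hdep => ?_⟩
  obtain ⟨C', D', k', hequiv', hC', hD', hlt⟩ :=
    (hequiv.independentBC hind).exists_equivalentBC_lt hC hD hdep
  exact hlt.not_ge (hmin ⟨C', D', hequiv.trans hequiv', hC', hD'⟩ hlt.le)

theorem IndependentBC.exists_isNormalizedBC {m : ℕ} {A B : Matrix (Fin m) (Fin m) ℂ}
    (hind : IndependentBC A B) : ∃ C D k, EquivalentBC A B C D ∧ IsNormalizedBC C D k := by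
  obtain ⟨C, D, k, hequiv, hC, hD, hlead⟩ := hind.exists_equivalentBC_linearIndependent
  let σ : Equiv.Perm (Fin m) := Tuple.sort fun j => OrderDual.toDual (k j)
  refine ⟨C.submatrix σ id, D.submatrix σ id, k ∘ σ, hequiv.trans (.submatrix C D σ),
    Tuple.monotone_sort fun j => OrderDual.toDual (k j),
    fun j s hs => ⟨hC (σ j) s hs, hD (σ j) s hs⟩, fun r => ?_⟩
  exact (hlead r).comp (Subtype.map σ fun _ => id) (Subtype.map_injective _ σ.injective)

theorem mainTheorem1 (n : ℕ) (hn : 0 < n) (A B : Matrix (Fin (2 * n)) (Fin (2 * n)) ℂ)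
    (hind : IndependentBC A B) (hdiss : IsDissipativeBC A B) :
    IsBirkhoffRegularBC n A B := by
  refine ⟨hind.exists_isNormalizedBC, fun C D k hequiv hnorm ω hω => ?_⟩
  have hnonneg (u w) (huw : C *ᵥ u + D *ᵥ w = 0) :
      0 ≤ (-1) ^ n * ((concomitant w).im - (concomitant u).im) :=
    hdiss.concomitant_nonneg hn (hequiv.mulVec_eq_zero huw)
  have heq (u w) (huw : principalPart k C *ᵥ u + principalPart k D *ᵥ w = 0) :
      (concomitant u).im = (concomitant w).im :=
    hnorm.concomitant_principalPart_eq (even_two_mul n)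
      (pow_ne_zero n (neg_ne_zero.2 one_ne_zero)) hnonneg huw
  obtain ⟨θzero, θpos, hθ⟩ :=
    exists_det_regularityMatrix_eq hn (fun j => C j (k j)) (fun j => D j (k j)) k ω
  exact ⟨_, θzero, θpos, hθ, Or.inl (det_leadingMatrix_ne_zero (even_two_mul n) hω heq)⟩
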